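/- Let $n\ge 2$ and let $\mathcal H^n$ be the $n$-dimensional hyperbolic space of curvature $-1$, with volume measure $\mu_n$, hyperbolic balls $B(x,r)$ and a fixed origin $0$. Put $\mathcal C_1=B(0,1)\setminus\{0\}$ and $\mathcal C_{j+1}=B(0,j+1)\setminus B(0,j)$ for $j\ge 1$. For a weight $w$ (a measurable function $w:\mathcal H^n\to[0,\infty)$), $s>0$ and measurable $A\subset\mathcal H^n$ write $w^s(A)=\int_A w^s\,d\mu_n\in[0,\infty]$, and for $r>0$ let $$A_{r,\alpha}f(x)=\frac{1}{\mu_n(B(x,r))^{1-\frac{\alpha}{n}}}\int_{B(x,r)}|f|\,d\mu_n .$$ Let $0<\alpha<n$, $1\le p<\frac n\alpha$, $\frac1q=\frac1p-\frac\alpha n$, let $\delta$ be a real number with $\delta<\min\left\{p,\ \frac qp+p-\frac{p}{1-\frac\alpha n}\right\}$, and let $C>0$. Put $$\beta=\frac{p}{(1-\frac\alpha n)(\frac qp+p-\delta)},\qquad \gamma=\frac{q}{\frac qp+p-\delta}.$$ Then $0<\beta<1$ and $\beta\le\gamma<p$, and there is a constant $C'>0$, depending only on $n,\alpha,p,\delta,C$,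 such that the following holds. If $w$ is a weight such that for all integers $j,l,r\ge1$ with $|l-j|\le r$, $$w^q(\mathcal C_l\cap B(x,r))\le C\,e^{(n-1)\frac{r+l-j}{2}(p-\delta)}\,e^{(n-1)r\delta}\,(w^p(x))^{\frac qp}\qquad\text{for a.e. }x\in\mathcal C_j,$$ then for every real $r\ge1$ and all measurable sets $E,F\subset\mathcal H^n$, $$\int_F A_{r,\alpha}(\chi_E)\,w^q\,d\mu_n\le C'\,e^{(n-1)r(1-\frac\alpha n)(\beta-1)}\,w^p(E)^{\frac\gamma p}\,w^q(F)^{1-\frac\gamma q}$$ (with the convention $0\cdot\infty=0$ on the right-hand side). -/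

import Mathlib

open MeasureTheory Set
open scoped ENNReal NNReal

noncomputable section

namespace Hyperbolic

/-- The points of `n`-dimensional hyperbolic space, in the hyperboloid model
`{(t, x) ∈ ℝ × ℝⁿ : t² - |x|² = 1, t > 0}`.  This sheet is the graph of `t = √(1 + |x|²)`,
and a point of it is recorded by its component `x ∈ ℝⁿ`.  The origin is `x = 0`. -/
abbrev Point (n : ℕ) : Type := EuclideanSpace ℝ (Fin n)

/-- The coordinate `t = √(1 + |x|²)` of the point `x`. -/
def height {n : ℕ} (x : Point n) : ℝ := Real.sqrt (1 + ‖x‖ ^ 2)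

/-- The hyperbolic distance: `cosh d(x, y) = √(1 + |x|²) √(1 + |y|²) - ⟨x, y⟩`. -/
def hdist {n : ℕ} (x y : Point n) : ℝ :=
  Real.arcosh (height x * height y - inner ℝ x y)

/-- The hyperbolic ball `B(x, r)`. -/
def hball {n : ℕ} (x : Point n) (r : ℝ) : Set (Point n) := {y | hdist x y < r}

/-- The hyperbolic volume `μ_n`.  The Minkowski form `|dx|² - dt²` restricts to the hyperboloid as
`|dx|² - ⟨x, dx⟩² / (1 + |x|²)`, whose determinant is `1 / (1 + |x|²)`, so that the Riemannian
volume is `dx / √(1 + |x|²)`. -/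
def hvol (n : ℕ) : Measure (Point n) :=
  (volume : Measure (Point n)).withDensity fun x => ENNReal.ofReal (1 / height x)

/-- The annuli `C_1 = B(0, 1) \ {0}` and `C_{j+1} = B(0, j+1) \ B(0, j)` for `j ≥ 1`
(the index `0` is not used). -/
def annulus (n : ℕ) : ℕ → Set (Point n)
  | 0 => ∅
  | 1 => hball 0 1 \ {0}
  | j + 2 => hball 0 ((j : ℝ) + 2) \ hball 0 ((j : ℝ) + 1)

/-- `w^s(A) = ∫_A w^s dμ_n`. -/
def weightMass {n : ℕ} (w : Point n → ℝ≥0) (s : ℝ) (A : Set (Point n)) : ℝ≥0∞ :=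
  ∫⁻ x in A, (w x : ℝ≥0∞) ^ s ∂(hvol n)

/-- The fractional average
`A_{r,α} f(x) = μ_n(B(x, r))^{-(1 - α/n)} ∫_{B(x, r)} |f| dμ_n`. -/
def fracAverage {n : ℕ} (α r : ℝ) (f : Point n → ℝ) (x : Point n) : ℝ≥0∞ :=
  (∫⁻ y in hball x r, ‖f y‖ₑ ∂(hvol n)) / hvol n (hball x r) ^ (1 - α / (n : ℝ))

/-- The growth condition at each level, with constant `C`: for all integers `j, l, r ≥ 1` with
`|l - j| ≤ r` and almost every `x ∈ C_j`,
`w^q(C_l ∩ B(x, r)) ≤ C e^{(n-1) (r+l-j)/2 (p-δ)} e^{(n-1) r δ} (w^p(x))^{q/p}`. -/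
def LevelCondition {n : ℕ} (p q δ C : ℝ) (w : Point n → ℝ≥0) : Prop :=
  ∀ j l r : ℕ, 1 ≤ j → 1 ≤ l → 1 ≤ r → |(l : ℤ) - (j : ℤ)| ≤ (r : ℤ) →
    ∀ᵐ x ∂(hvol n), x ∈ annulus n j →
      weightMass w q (annulus n l ∩ hball x (r : ℝ)) ≤
        ENNReal.ofReal (C * Real.exp (((n : ℝ) - 1) * (((r : ℝ) + l - j) / 2) * (p - δ)) *
          Real.exp (((n : ℝ) - 1) * r * δ)) * ((w x : ℝ≥0∞) ^ p) ^ (q / p)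

/-- The two-set inequality with constant `C`: for every real `r ≥ 1` and all measurable `E`, `F`,
`∫_F A_{r,α}(χ_E) w^q dμ_n ≤ C e^{(n-1) r (1-α/n) (β-1)} w^p(E)^{γ/p} w^q(F)^{1-γ/q}`. -/
def TwoSetCondition {n : ℕ} (α p q β γ C : ℝ) (w : Point n → ℝ≥0) : Prop :=
  ∀ r : ℝ, 1 ≤ r → ∀ E F : Set (Point n),
    NullMeasurableSet E (hvol n) → NullMeasurableSet F (hvol n) →
      ∫⁻ y in F, fracAverage α r (E.indicator fun _ => (1 : ℝ)) y * (w y : ℝ≥0∞) ^ q ∂(hvol n) ≤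
        ENNReal.ofReal (C * Real.exp (((n : ℝ) - 1) * r * (1 - α / (n : ℝ)) * (β - 1))) *
          weightMass w p E ^ (γ / p) * weightMass w q F ^ (1 - γ / q)

end Hyperbolic

end

/-!
The exponents are elementary consequences of `1/q = 1/p - α/n` and of the two bounds on `δ`. For the
inequality, write `d` for the hyperbolic distance, `ν = n - 1`, `D = q/p + p - δ`, and let the level
of a point be the index of its annulus. The denominator of the average is disposed of by
`μ(B(y, r)) ≳ e^{ν r}` (`exists_le_hvol_hball`), and it remains to bound the double integral of
`w(y)^q` over the pairs `x ∈ E`, `y ∈ F` with `d(x, y) < r`. It is cut into slices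
`level x = level y + m`, `m ∈ ℤ`, each of which is bounded in two ways.

* For fixed `y`, the `x` in the slice fill a volume `≲ e^{ν (r + m) / 2}` (`exists_hvol_ballSlice_le`),
  so that the slice is at most `B e^{ν (r + m) / 2} w^q(F)`.
* For fixed `x`, the `w^q`-mass of the `y` in `F` and in the slice is at most `w^q(F)`, and by the
  growth condition at most `M_m w(x)^q`, where `M_m` is a constant times
  `e^{ν (r - m) (p - δ) / 2} e^{ν r δ}`. The weighted geometric mean of these bounds with weights
  `1 - p/q` and `p/q`, integrated over `x ∈ E`, gives `w^q(F)^{1 - p/q} M_m^{p/q} w^p(E)`.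

The first bound grows geometrically in `m` and the second decays geometrically, because `δ < p`.
Hence the sum over `m` of their minimum is comparable to its largest term
(`exists_tsum_min_exp_le`), which is the geometric mean of the two bounds with the weights that
cancel `m`, namely `(p - δ)/D` and `(q/p)/D = γ/p`. This mean is a constant times
`e^{ν r p / D} w^p(E)^{γ/p} w^q(F)^{1 - γ/q}`, and `p / D = (1 - α/n) β`.

Both volume estimates are obtained without polar coordinates, by comparing with boxes in Euclidean
coordinates whose first axis points to the centre of the ball (`hvol_level_inter_hball_le` and
`exists_le_hvol_hball`).
-/

namespace Hyperbolic

/-! ### The hyperboloid model -/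

variable {n : ℕ}

lemma height_sq (x : Point n) : height x ^ 2 = 1 + ‖x‖ ^ 2 :=
  Real.sq_sqrt (by positivity)

lemma one_le_height (x : Point n) : 1 ≤ height x :=
  Real.one_le_sqrt.2 (by nlinarith [sq_nonneg ‖x‖])

lemma height_pos (x : Point n) : 0 < height x := one_pos.trans_le (one_le_height x)

lemma height_zero : height (0 : Point n) = 1 := by simp [height]

lemma continuous_height : Continuous (height : Point n → ℝ) := by
  unfold height; fun_prop

lemma hdist_zero_left (x : Point n) : hdist 0 x = Real.arcosh (height x) := by
  simp [hdist, height_zero]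

lemma height_eq_cosh (x : Point n) : height x = Real.cosh (hdist 0 x) := by
  rw [hdist_zero_left, Real.cosh_arcosh (one_le_height x)]

lemma norm_eq_sinh (x : Point n) : ‖x‖ = Real.sinh (hdist 0 x) := by
  rw [hdist_zero_left, Real.sinh_arcosh (one_le_height x), height_sq]
  simp

lemma hdist_zero_nonneg (x : Point n) : 0 ≤ hdist 0 x := by
  rw [hdist_zero_left]; exact Real.arcosh_nonneg (one_le_height x)

/-- Cauchy–Schwarz in the form `cosh d(x, y) ≥ cosh (d(0, x) - d(0, y))`. -/
lemma cosh_sub_le (x y : Point n) :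
    Real.cosh (hdist 0 x - hdist 0 y) ≤ height x * height y - inner ℝ x y := by
  rw [Real.cosh_sub, ← height_eq_cosh, ← height_eq_cosh, ← norm_eq_sinh, ← norm_eq_sinh]
  linarith [real_inner_le_norm x y]

lemma hdist_lt_iff {x y : Point n} {r : ℝ} (hr : 0 < r) :
    hdist x y < r ↔ height x * height y - inner ℝ x y < Real.cosh r := by
  have h1 : 1 ≤ height x * height y - inner ℝ x y :=
    (Real.one_le_cosh _).trans (cosh_sub_le x y)
  rw [hdist, ← Real.arcosh_lt_arcosh (by linarith) (Real.cosh_pos r), Real.arcosh_cosh hr.le]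

lemma hdist_comm (x y : Point n) : hdist x y = hdist y x := by
  rw [hdist, hdist, mul_comm, real_inner_comm]

/-- The triangle inequality with the origin as one of the three points. -/
lemma abs_hdist_zero_sub_lt {x y : Point n} {r : ℝ} (hr : 0 < r) (h : hdist x y < r) :
    |hdist 0 x - hdist 0 y| < r := by
  have := (cosh_sub_le x y).trans_lt ((hdist_lt_iff hr).1 h)
  rwa [Real.cosh_lt_cosh, abs_of_pos hr] at this

lemma measurableSet_hdist_lt {r : ℝ} (hr : 0 < r) :
    MeasurableSet {z : Point n × Point n | hdist z.1 z.2 < r} := by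
  simp_rw [hdist_lt_iff hr]
  have h := continuous_height (n := n)
  exact (isOpen_lt (by fun_prop) continuous_const).measurableSet

lemma measurableSet_hball (x : Point n) {r : ℝ} (hr : 0 < r) : MeasurableSet (hball x r) := by
  have h := continuous_height (n := n)
  simp_rw [hball, hdist_lt_iff hr]
  exact (isOpen_lt (by fun_prop) continuous_const).measurableSet

/-- The index of the annulus containing a point: for `x ≠ 0` and `j ≥ 1`, `x ∈ C_j` if and only if
`level x = j`. The origin gets level `1`. -/
noncomputable def level (x : Point n) : ℕ := ⌊hdist 0 x⌋₊ + 1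

lemma level_sub_one_le (x : Point n) : (level x : ℝ) - 1 ≤ hdist 0 x := by
  simpa [level] using Nat.floor_le (hdist_zero_nonneg x)

lemma lt_level (x : Point n) : hdist 0 x < level x := by
  simpa [level] using Nat.lt_floor_add_one (hdist 0 x)

lemma measurable_hdist_zero : Measurable (fun x : Point n => hdist 0 x) := by
  simp_rw [hdist_zero_left]
  have h := (continuous_height (n := n)).measurable
  unfold Real.arcosh
  fun_prop

lemma measurable_level : Measurable (level : Point n → ℕ) :=
  (Nat.measurable_floor.comp measurable_hdist_zero).add_const 1

lemma level_eq_iff {x : Point n} {j : ℕ} (hj : 1 ≤ j) :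
    level x = j ↔ (j : ℝ) - 1 ≤ hdist 0 x ∧ hdist 0 x < j := by
  constructor
  · rintro rfl
    exact ⟨level_sub_one_le x, lt_level x⟩
  · rintro ⟨h1, h2⟩
    obtain ⟨k, rfl⟩ := Nat.exists_eq_add_of_le' hj
    push_cast at h1 h2
    rw [level, Nat.floor_eq_iff (hdist_zero_nonneg x) |>.2 ⟨by linarith, h2⟩]

lemma mem_annulus_iff {x : Point n} (hx : x ≠ 0) {j : ℕ} (hj : 1 ≤ j) :
    x ∈ annulus n j ↔ level x = j := by
  rw [level_eq_iff hj]
  match j, hj with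
  | 1, _ => simp [annulus, hball, hx, hdist_zero_nonneg x]
  | j + 2, _ =>
    simp only [annulus, hball, mem_sdiff, mem_ofPred_eq, not_lt]
    push_cast
    constructor
    · rintro ⟨h1, h2⟩; exact ⟨by linarith, h1⟩
    · rintro ⟨h1, h2⟩; exact ⟨h2, by linarith⟩

lemma abs_level_sub_lt {x y : Point n} {r : ℝ} (hr : 0 < r) (h : hdist x y < r) :
    |(level x : ℝ) - level y| < r + 1 := by
  have h0 := abs_lt.1 (abs_hdist_zero_sub_lt hr h)
  have := level_sub_one_le x
  have := level_sub_one_le y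
  have := lt_level x
  have := lt_level y
  rw [abs_lt]; constructor <;> linarith

end Hyperbolic

/-! ### A two-sided geometric series -/

/-- The sum over `m ∈ ℤ` of `min (x e^{-am}) (y e^{bm})` is comparable to its largest term: the two
sequences cross where `m` is close to `m₀ = log (x / y) / (a + b)`, the common value there is
`x^θ y^{1-θ}` with `θ = b / (a + b)`, and the terms decay geometrically on both sides of `m₀`. -/
theorem exists_tsum_min_exp_le {a b : ℝ} (ha : 0 < a) (hb : 0 < b) :
    ∃ S : ℝ, 0 < S ∧ ∀ x y : ℝ≥0∞,
      ∑' m : ℤ, min (x * ENNReal.ofReal (Real.exp (-(a * m))))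
        (y * ENNReal.ofReal (Real.exp (b * m))) ≤
        ENNReal.ofReal S * (x ^ (b / (a + b)) * y ^ (a / (a + b))) := by
  set c := min a b with hc
  have hc0 : 0 < c := lt_min ha hb
  have hsum : Summable fun m : ℤ => Real.exp (-(c * |(m : ℝ)|)) := by
    have h : Summable fun k : ℕ => Real.exp (-(c * k)) := by
      have := Real.summable_exp_nat_mul_iff.2 (neg_lt_zero.2 hc0)
      refine this.congr fun k => by ring_nf
    refine Summable.of_nat_of_neg ?_ ?_ <;> simpa using h
  have hS0 : 0 < ∑' m : ℤ, Real.exp (-(c * |(m : ℝ)|)) :=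
    hsum.tsum_pos (fun _ => (Real.exp_pos _).le) 0 (Real.exp_pos _)
  refine ⟨Real.exp c * ∑' m : ℤ, Real.exp (-(c * |(m : ℝ)|)), by positivity, fun x y => ?_⟩
  have hab : 0 < a + b := by positivity
  have ht : 0 < b / (a + b) := by positivity
  have ht' : 0 < a / (a + b) := by positivity
  rcases eq_or_ne x 0 with rfl | hx0
  · simp
  rcases eq_or_ne y 0 with rfl | hy0
  · simp
  have hS : ENNReal.ofReal (Real.exp c * ∑' m : ℤ, Real.exp (-(c * |(m : ℝ)|))) ≠ 0 := by
    rw [Ne, ENNReal.ofReal_eq_zero, not_le]; positivity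
  rcases eq_or_ne x ⊤ with rfl | hx
  · rw [ENNReal.top_rpow_of_pos ht, ENNReal.top_mul, ENNReal.mul_top hS]
    · exact le_top
    · simp [ENNReal.rpow_eq_zero_iff, hy0, ht'.not_gt]
  rcases eq_or_ne y ⊤ with rfl | hy
  · rw [ENNReal.top_rpow_of_pos ht', ENNReal.mul_top, ENNReal.mul_top hS]
    · exact le_top
    · simp [ENNReal.rpow_eq_zero_iff, hx0, ht.not_gt]
  obtain ⟨u, rfl⟩ : ∃ u : ℝ, x = ENNReal.ofReal (Real.exp u) := by
    refine ⟨Real.log x.toReal, ?_⟩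
    rw [Real.exp_log (ENNReal.toReal_pos hx0 hx), ENNReal.ofReal_toReal hx]
  obtain ⟨v, rfl⟩ : ∃ v : ℝ, y = ENNReal.ofReal (Real.exp v) := by
    refine ⟨Real.log y.toReal, ?_⟩
    rw [Real.exp_log (ENNReal.toReal_pos hy0 hy), ENNReal.ofReal_toReal hy]
  set m₀ : ℝ := (u - v) / (a + b) with hm₀
  set t : ℝ := u * (b / (a + b)) + v * (a / (a + b)) with ht0
  have hu : u = t + a * m₀ := by rw [ht0, hm₀]; field_simp; ring
  have hv : v = t - b * m₀ := by rw [ht0, hm₀]; field_simp; ring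
  have hV : ENNReal.ofReal (Real.exp u) ^ (b / (a + b)) *
      ENNReal.ofReal (Real.exp v) ^ (a / (a + b)) =
      ENNReal.ofReal (Real.exp t) := by
    rw [ENNReal.ofReal_rpow_of_pos (Real.exp_pos _), ENNReal.ofReal_rpow_of_pos (Real.exp_pos _),
      ← ENNReal.ofReal_mul (by positivity), ← Real.exp_mul, ← Real.exp_mul, ← Real.exp_add]
  rw [hV, mul_comm, ENNReal.ofReal_mul (Real.exp_pos _).le, ENNReal.ofReal_tsum_of_nonneg
    (fun _ => (Real.exp_pos _).le) hsum, ← ENNReal.tsum_mul_left, ← ENNReal.tsum_mul_left,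
    ← (Equiv.addRight ⌊m₀⌋).tsum_eq]
  -- After the shift by `⌊m₀⌋` the crossing point is in `[0, 1)`, which costs the factor `exp c`.
  refine ENNReal.tsum_le_tsum fun m => ?_
  simp only [Equiv.coe_addRight, Int.cast_add]
  rw [← ENNReal.ofReal_mul (by positivity), ← ENNReal.ofReal_mul (by positivity),
    ← ENNReal.ofReal_mul (by positivity), ← ENNReal.ofReal_mul (by positivity), ← Real.exp_add,
    ← Real.exp_add, ← Real.exp_add, ← Real.exp_add]
  have hf1 := Int.floor_le m₀
  have hf2 := Int.lt_floor_add_one m₀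
  have hca : c ≤ a := min_le_left _ _
  have hcb : c ≤ b := min_le_right _ _
  rcases le_or_gt 1 m with hm | hm
  · refine (min_le_left _ _).trans (ENNReal.ofReal_le_ofReal (Real.exp_le_exp.2 ?_))
    have hm' : (1 : ℝ) ≤ m := by exact_mod_cast hm
    rw [abs_of_nonneg (by linarith), hu]
    nlinarith
  · refine (min_le_right _ _).trans (ENNReal.ofReal_le_ofReal (Real.exp_le_exp.2 ?_))
    have hm' : (m : ℝ) ≤ 0 := by exact_mod_cast (by omega : m ≤ 0)
    rw [abs_of_nonpos hm', hv]
    nlinarith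

namespace Hyperbolic

/-! ### Volumes of balls and of their intersections with annuli -/

variable {n : ℕ}

lemma hvol_le_of_subset {S T : Set (Point n)} {M : ℝ} (hS : MeasurableSet S) (hST : S ⊆ T)
    (hM : ∀ x ∈ S, 1 / height x ≤ M) : hvol n S ≤ ENNReal.ofReal M * volume T := by
  rw [hvol, withDensity_apply _ hS]
  calc _ ≤ ∫⁻ _ in S, ENNReal.ofReal M :=
        setLIntegral_mono' hS fun x hx => ENNReal.ofReal_le_ofReal (hM x hx)
    _ = ENNReal.ofReal M * volume S := setLIntegral_const _ _
    _ ≤ _ := by gcongr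

lemma le_hvol_of_subset {S T : Set (Point n)} {M : ℝ} (hT : MeasurableSet T) (hTS : T ⊆ S)
    (hM : ∀ x ∈ T, M ≤ 1 / height x) : ENNReal.ofReal M * volume T ≤ hvol n S := by
  refine le_trans ?_ (measure_mono hTS)
  rw [hvol, withDensity_apply _ hT, ← setLIntegral_const]
  exact setLIntegral_mono' hT fun x hx => ENNReal.ofReal_le_ofReal (hM x hx)

/-- A rotation taking `y` to the positive half of the `i₀`-th coordinate axis. -/
lemma exists_rotation (i₀ : Fin n) (y : Point n) :
    ∃ U : Point n ≃ₗᵢ[ℝ] Point n, U y = EuclideanSpace.single i₀ ‖y‖ :=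
  ⟨_, Submodule.reflection_sub (v := y) (w := EuclideanSpace.single i₀ ‖y‖) (by simp)⟩

lemma inner_eq_of_rotation {i₀ : Fin n} {y : Point n} {U : Point n ≃ₗᵢ[ℝ] Point n}
    (hU : U y = EuclideanSpace.single i₀ ‖y‖) (x : Point n) : inner ℝ y x = ‖y‖ * U x i₀ := by
  rw [← U.inner_map_map, hU, EuclideanSpace.inner_single_left]
  simp

lemma height_sq_eq_of_rotation (i₀ : Fin n) (U : Point n ≃ₗᵢ[ℝ] Point n) (x : Point n) :
    height x ^ 2 = 1 + U x i₀ ^ 2 + ∑ i ∈ Finset.univ.erase i₀, U x i ^ 2 := by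
  rw [height_sq, ← U.norm_map, EuclideanSpace.real_norm_sq_eq,
    ← Finset.add_sum_erase _ _ (Finset.mem_univ i₀), add_assoc]

/-- The box `[a, b] × [c, d]^{n-1}`, with the first factor in the direction of the `i₀`-th axis. -/
def box (i₀ : Fin n) (a b c d : ℝ) : Set (Point n) :=
  {x | ∀ i, x i ∈ if i = i₀ then Icc a b else Icc c d}

lemma mem_box {i₀ : Fin n} {a b c d : ℝ} {x : Point n} :
    x ∈ box i₀ a b c d ↔ x i₀ ∈ Icc a b ∧ ∀ i ≠ i₀, x i ∈ Icc c d := by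
  refine ⟨fun h => ⟨by simpa using h i₀, fun i hi => by simpa [hi] using h i⟩, fun h i => ?_⟩
  split_ifs with hi
  · exact hi ▸ h.1
  · exact h.2 i hi

lemma measurableSet_box (i₀ : Fin n) (a b c d : ℝ) : MeasurableSet (box i₀ a b c d) := by
  have : box i₀ a b c d = WithLp.ofLp ⁻¹' pi univ fun i => if i = i₀ then Icc a b else Icc c d := by
    ext x; simp [box, Set.mem_pi]
  rw [this]
  refine (PiLp.volume_preserving_ofLp (Fin n)).measurable (MeasurableSet.univ_pi fun i => ?_)
  split_ifs <;> exact measurableSet_Icc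

lemma volume_preimage_box (i₀ : Fin n) (a b c d : ℝ) (U : Point n ≃ₗᵢ[ℝ] Point n) :
    volume (U ⁻¹' box i₀ a b c d) = ENNReal.ofReal (b - a) * ENNReal.ofReal (d - c) ^ (n - 1) := by
  have : box i₀ a b c d = WithLp.ofLp ⁻¹' pi univ fun i => if i = i₀ then Icc a b else Icc c d := by
    ext x; simp [box, Set.mem_pi]
  have hm : MeasurableSet (pi univ fun i => if i = i₀ then Icc a b else Icc c d) :=
    MeasurableSet.univ_pi fun i => by split_ifs <;> exact measurableSet_Icc
  rw [U.measurePreserving.measure_preimage (measurableSet_box ..).nullMeasurableSet, this,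
    (PiLp.volume_preserving_ofLp (Fin n)).measure_preimage hm.nullMeasurableSet, volume_pi_pi,
    ← Finset.mul_prod_erase _ _ (Finset.mem_univ i₀),
    Finset.prod_congr rfl (g := fun _ => ENNReal.ofReal (d - c))]
  · simp
  · intro i hi
    simp [Finset.ne_of_mem_erase hi]

/-- A bound for the component `v` of `x ∈ B(y, r)` orthogonal to `y`: if `h` is the height of `x`,
`H` that of `y`, and `u` the component of `x` along `y`, then `1 + v² = (h - u) (h + u)`. If `u ≥ 0`,
then `h + u ≤ 2 h` and `(h - u) H ≤ cosh d(x, y)`, since `|y| ≤ H`; if `u ≤ 0`, then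
`h H ≤ cosh d(x, y)`. -/
lemma sq_sub_sq_le_of_hdist_lt {y x : Point n} {r u : ℝ} (hr : 0 < r) (h : hdist y x < r)
    (hu : inner ℝ y x = ‖y‖ * u) (hux : u ^ 2 ≤ height x ^ 2) :
    (height x ^ 2 - u ^ 2) * height y ≤ 2 * height x * Real.cosh r := by
  rw [hdist_lt_iff hr, hu] at h
  have hx := one_le_height x
  have hY := height_sq y
  have hy := height_pos y
  have hyn : ‖y‖ ≤ height y := by nlinarith [norm_nonneg y]
  have hux' := abs_le_of_sq_le_sq' hux (by linarith)
  rcases le_total 0 u with h0 | h0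
  · have h1 : (height x - u) * height y ≤ Real.cosh r := by nlinarith
    calc (height x ^ 2 - u ^ 2) * height y = (height x + u) * ((height x - u) * height y) := by ring
      _ ≤ (height x + u) * Real.cosh r := by gcongr
      _ ≤ 2 * height x * Real.cosh r := by gcongr; linarith
  · have h1 : height x * height y ≤ Real.cosh r := by nlinarith [norm_nonneg y]
    nlinarith [sq_nonneg u]

lemma height_lt_exp_level (x : Point n) : height x ≤ Real.exp (level x) := by
  rw [height_eq_cosh]
  have h0 := hdist_zero_nonneg x
  have h := Real.exp_le_exp.2 (lt_level x).le
  have h' := Real.exp_le_exp.2 (by linarith : -hdist 0 x ≤ hdist 0 x)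
  rw [Real.cosh_eq]
  linarith

lemma exp_level_le_height (x : Point n) : Real.exp ((level x : ℝ) - 1) ≤ 2 * height x := by
  rw [height_eq_cosh, Real.cosh_eq]
  have h := Real.exp_le_exp.2 (level_sub_one_le x)
  have := Real.exp_pos (-hdist 0 x)
  linarith

lemma cosh_le_exp {r : ℝ} (hr : 0 ≤ r) : Real.cosh r ≤ Real.exp r := by
  have h' := Real.exp_le_exp.2 (by linarith : -r ≤ r)
  rw [Real.cosh_eq]
  linarith

/-- `μ(C_j ∩ B(y, r)) ≲ e^{(n-1)(r+j-l)/2}` for `y ∈ C_l`: in coordinates adapted to `y`, the set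
lies in a box of sides comparable to `e^j` along `y` and `e^{(r+j-l)/2}` orthogonally to `y`,
and the density of `μ` there is comparable to `e^{-j}`. -/
theorem hvol_level_inter_hball_le (hn : 2 ≤ n) (y : Point n) {r : ℝ} (hr : 0 < r) (j : ℕ) :
    hvol n {x | hdist y x < r ∧ level x = j} ≤
      ENNReal.ofReal (4 * Real.exp 1 * (4 * Real.exp (1 / 2)) ^ (n - 1) *
        Real.exp (((n : ℝ) - 1) * ((r + j - level y) / 2))) := by
  obtain ⟨U, hU⟩ := exists_rotation (⟨0, by omega⟩ : Fin n) y
  set i₀ : Fin n := ⟨0, by omega⟩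
  set ρ : ℝ := 2 * Real.exp ((r + j - level y + 1) / 2) with hρ
  have hρ0 : 0 < ρ := by positivity
  have hS : MeasurableSet {x : Point n | hdist y x < r ∧ level x = j} :=
    (measurableSet_hball y hr).inter (measurable_level (measurableSet_singleton j))
  have hsub : {x : Point n | hdist y x < r ∧ level x = j} ⊆
      U ⁻¹' box i₀ (-Real.exp j) (Real.exp j) (-ρ) ρ := by
    rintro x ⟨hx, hj⟩
    have hsq := height_sq_eq_of_rotation i₀ U x
    have hnn : ∀ i ∈ Finset.univ.erase i₀, 0 ≤ U x i ^ 2 := fun i _ => sq_nonneg _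
    have hux : U x i₀ ^ 2 ≤ height x ^ 2 := by linarith [Finset.sum_nonneg hnn]
    have hle := height_lt_exp_level x
    rw [hj] at hle
    refine mem_box.2 ⟨?_, fun i hi => ?_⟩
    · have := abs_le_of_sq_le_sq' hux (height_pos x).le
      exact ⟨by linarith, by linarith⟩
    · have h1 := sq_sub_sq_le_of_hdist_lt hr hx (inner_eq_of_rotation hU x) hux
      have h2 : U x i ^ 2 ≤ height x ^ 2 - U x i₀ ^ 2 := by
        have := Finset.single_le_sum hnn (Finset.mem_erase.2 ⟨hi, Finset.mem_univ i⟩)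
        linarith
      have h3 := exp_level_le_height y
      have h4 : 2 * height x * Real.cosh r ≤ 2 * Real.exp j * Real.exp r := by
        gcongr
        exact cosh_le_exp hr.le
      have h5 : U x i ^ 2 * Real.exp ((level y : ℝ) - 1) ≤ 4 * Real.exp j * Real.exp r := by
        have := mul_le_mul_of_nonneg_left h3 (sq_nonneg (U x i))
        have := mul_le_mul_of_nonneg_right h2 (height_pos y).le
        linarith
      have h6 : ρ ^ 2 * Real.exp ((level y : ℝ) - 1) = 4 * Real.exp j * Real.exp r := by
        rw [hρ, mul_pow, ← Real.exp_nat_mul, mul_assoc, ← Real.exp_add, mul_assoc, ← Real.exp_add]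
        congr 1
        · norm_num
        · congr 1
          push_cast
          ring
      rw [← h6] at h5
      exact abs_le_of_sq_le_sq' (le_of_mul_le_mul_right h5 (Real.exp_pos _)) hρ0.le
  -- On the annulus the density `1 / height` is at most `2 e^{1-j}`.
  refine (hvol_le_of_subset (M := 2 * Real.exp (1 - j)) hS hsub ?_).trans ?_
  · rintro x ⟨-, hj⟩
    have h3 := exp_level_le_height x
    rw [hj] at h3
    rw [div_le_iff₀ (height_pos x)]
    have : Real.exp (1 - (j : ℝ)) * Real.exp ((j : ℝ) - 1) = 1 := by
      rw [← Real.exp_add]; simp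
    nlinarith [Real.exp_pos (1 - (j : ℝ))]
  · rw [volume_preimage_box, ← ENNReal.ofReal_pow (by linarith), ← ENNReal.ofReal_mul
      (by linarith [Real.exp_pos (j : ℝ)]), ← ENNReal.ofReal_mul (by positivity)]
    apply ENNReal.ofReal_le_ofReal
    apply le_of_eq
    have e1 : ρ - -ρ = 4 * Real.exp (1 / 2) * Real.exp ((r + j - level y) / 2) := by
      rw [hρ, mul_assoc, ← Real.exp_add,
        show (1 : ℝ) / 2 + (r + j - level y) / 2 = (r + j - level y + 1) / 2 by ring]
      ring
    have e2 : Real.exp ((r + j - level y) / 2) ^ (n - 1)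
        = Real.exp (((n : ℝ) - 1) * ((r + j - level y) / 2)) := by
      rw [← Real.exp_nat_mul, Nat.cast_sub (by omega), Nat.cast_one]
    have e3 : Real.exp (1 - (j : ℝ)) * Real.exp j = Real.exp 1 := by
      rw [← Real.exp_add]; simp
    rw [e1, mul_pow _ (Real.exp ((r + j - level y) / 2)), e2, ← e3]
    ring

/-- With `y = (Y, 0)`, `x = (u, v)` and `k² = 1 + |v|²`, one has
`(h H)² = (k + u Y)² + (u - k Y)²`, so that `cosh d(x, y) = h H - u Y` exceeds `k` only by a small
multiple of `k` as long as `u - k Y` is a small multiple of `k H`. -/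
lemma mul_sub_mul_le {h H Y K k u : ℝ} (hH : H ^ 2 = 1 + Y ^ 2) (hY : 0 ≤ Y) (hH0 : 0 < H)
    (hK : 0 < K) (hk : K ≤ k) (hk' : k ≤ 5 / 4 * K) (hh : h ^ 2 = k ^ 2 + u ^ 2)
    (hu : 5 / 4 * K * Y ≤ u) (hu' : u ≤ 5 / 4 * K * Y + K * H / 4) :
    h * H - u * Y ≤ 9 / 8 * k := by
  have hYH : Y ≤ H := by nlinarith
  have hk0 : 0 < k := hK.trans_le hk
  have h1 : 0 ≤ u - k * Y := by linarith [mul_le_mul_of_nonneg_right hk' hY]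
  have h2 : u - k * Y ≤ k * H / 2 := by
    linarith [mul_le_mul_of_nonneg_right hk hY, mul_le_mul_of_nonneg_left hYH hK.le,
      mul_le_mul_of_nonneg_right hk hH0.le]
  have h3 : k * H ^ 2 ≤ k + u * Y := by
    rw [hH]
    linarith [mul_nonneg h1 hY]
  have h4 : (u - k * Y) ^ 2 ≤ k * (k + u * Y) / 4 := by
    calc (u - k * Y) ^ 2 ≤ (k * H / 2) ^ 2 := by gcongr
      _ = k * (k * H ^ 2) / 4 := by ring
      _ ≤ _ := by gcongr
  have h5 : 0 ≤ u * Y := by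
    have : 0 ≤ u := le_trans (by positivity) hu
    positivity
  have h6 : (h * H) ^ 2 ≤ (k + u * Y + k / 8) ^ 2 := by
    have : (h * H) ^ 2 = (k + u * Y) ^ 2 + (u - k * Y) ^ 2 := by
      rw [mul_pow, hh, hH]; ring
    rw [this]
    linarith [sq_nonneg k]
  linarith [abs_le_of_sq_le_sq' h6 (by positivity)]

lemma three_halves_le_cosh {r : ℝ} (hr : 1 ≤ r) : 3 / 2 ≤ Real.cosh r := by
  have h1 : Real.cosh 1 ≤ Real.cosh r := by
    rw [Real.cosh_le_cosh, abs_one, abs_of_pos (by linarith)]; exact hr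
  have h2 : 3 / 2 ≤ Real.cosh 1 := by
    rw [Real.cosh_eq]
    have := Real.exp_one_gt_d9
    have : 0.36 < Real.exp (-1) := lt_trans (by norm_num) Real.exp_neg_one_gt_d9
    linarith
  exact h2.trans h1

/-- `μ(B(y, r)) ≳ e^{(n-1) r}` for `r ≥ 1`, uniformly in the centre: in coordinates adapted to `y`,
the ball contains a box of sides comparable to `e^r height y` along `y` and to `e^r` orthogonally to
`y`, on which the density of `μ` is comparable to `1 / (e^r height y)`. -/
theorem exists_le_hvol_hball (hn : 2 ≤ n) :
    ∃ c : ℝ, 0 < c ∧ ∀ (y : Point n) (r : ℝ), 1 ≤ r →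
      ENNReal.ofReal (c * Real.exp (((n : ℝ) - 1) * r)) ≤ hvol n (hball y r) := by
  set ν : ℝ := (n : ℝ) - 1 with hν
  have hν0 : 0 < ν := by
    have : (2 : ℝ) ≤ n := by exact_mod_cast hn
    linarith
  refine ⟨1 / 11 * (1 / (8 * √(20 * ν))) ^ (n - 1), by positivity, fun y r hr => ?_⟩
  obtain ⟨U, hU⟩ := exists_rotation (⟨0, by omega⟩ : Fin n) y
  set i₀ : Fin n := ⟨0, by omega⟩
  have hcosh := three_halves_le_cosh hr
  -- The factor `20` makes `9/8 * (5/4 * K) < cosh r` hold for all `r ≥ 1`, where `9/8 * (5/4 * K)`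
  -- bounds `cosh d(x, y)` on the box and `K² = 1 + cosh² r / 20`.
  set V : ℝ := Real.cosh r / √(20 * ν) with hV
  have hV0 : 0 < V := by positivity
  set K : ℝ := √(1 + ν * V ^ 2) with hK
  have hK0 : 0 < K := by positivity
  have hK2 : K ^ 2 = 1 + ν * V ^ 2 := Real.sq_sqrt (by positivity)
  have hV2 : ν * V ^ 2 = Real.cosh r ^ 2 / 20 := by
    rw [hV, div_pow, Real.sq_sqrt (by positivity)]; field_simp
  have hH := height_sq y
  have hH0 := height_pos y
  have hY0 := norm_nonneg y
  have hYH : ‖y‖ ≤ height y := by nlinarith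
  set a : ℝ := 5 / 4 * K * ‖y‖ with ha
  have hcard : ((Finset.univ.erase i₀).card : ℝ) = ν := by
    rw [Finset.card_erase_of_mem (Finset.mem_univ _), Finset.card_univ, Fintype.card_fin,
      Nat.cast_sub (by omega), Nat.cast_one]
  have key : ∀ x ∈ U ⁻¹' box i₀ a (a + K * height y / 4) V (5 / 4 * V),
      hdist y x < r ∧ 1 / (11 / 4 * K * height y) ≤ 1 / height x := by
    intro x hx
    obtain ⟨hx0, hxi⟩ := mem_box.1 hx
    have hsq := height_sq_eq_of_rotation i₀ U x
    have hlow : ν * V ^ 2 ≤ ∑ i ∈ Finset.univ.erase i₀, U x i ^ 2 := by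
      rw [← hcard, ← nsmul_eq_mul]
      refine Finset.card_nsmul_le_sum _ _ _ fun i hi => ?_
      have := hxi i (Finset.ne_of_mem_erase hi)
      exact pow_le_pow_left₀ hV0.le this.1 2
    have hupp : ∑ i ∈ Finset.univ.erase i₀, U x i ^ 2 ≤ ν * (5 / 4 * V) ^ 2 := by
      rw [← hcard, ← nsmul_eq_mul]
      refine Finset.sum_le_card_nsmul _ _ _ fun i hi => ?_
      have := hxi i (Finset.ne_of_mem_erase hi)
      exact pow_le_pow_left₀ (hV0.le.trans this.1) this.2 2
    set k : ℝ := √(1 + ∑ i ∈ Finset.univ.erase i₀, U x i ^ 2)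
    have hk2 : k ^ 2 = 1 + ∑ i ∈ Finset.univ.erase i₀, U x i ^ 2 :=
      Real.sq_sqrt (by positivity)
    have hk0 : 0 ≤ k := Real.sqrt_nonneg _
    have hKk : K ≤ k := le_of_sq_le_sq (by linarith) hk0
    have hkK : k ≤ 5 / 4 * K := le_of_sq_le_sq (by rw [mul_pow, hK2, hk2]; linarith) (by positivity)
    have hhk : height x ^ 2 = k ^ 2 + U x i₀ ^ 2 := by rw [hsq, hk2]; ring
    have hu0 : 0 ≤ U x i₀ := le_trans (by positivity) hx0.1
    constructor
    · rw [hdist_lt_iff (by linarith), inner_eq_of_rotation hU, mul_comm (height y), mul_comm ‖y‖]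
      refine (mul_sub_mul_le hH hY0 hH0 hK0 hKk hkK hhk hx0.1 hx0.2).trans_lt ?_
      have h1 : (9 / 8 * (5 / 4 * K)) ^ 2 < Real.cosh r ^ 2 := by
        rw [mul_pow, mul_pow, hK2, hV2]
        have := pow_le_pow_left₀ (by norm_num) hcosh 2
        norm_num at this ⊢
        linarith
      have h2 := abs_lt_of_sq_lt_sq' h1 (by linarith)
      linarith [h2.2]
    · have h1 : height x ≤ k + U x i₀ :=
        le_of_sq_le_sq (by linarith [mul_nonneg hk0 hu0]) (by positivity)
      have h2 := mul_le_mul_of_nonneg_left hYH hK0.le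
      have h3 := mul_le_mul_of_nonneg_left (one_le_height y) hK0.le
      refine one_div_le_one_div_of_le (height_pos x) ?_
      have := hx0.2
      linarith
  have hle := le_hvol_of_subset (S := hball y r)
    ((measurableSet_box i₀ a (a + K * height y / 4) V (5 / 4 * V)).preimage U.continuous.measurable)
    (fun x hx => (key x hx).1) (fun x hx => (key x hx).2)
  refine le_trans ?_ hle
  rw [volume_preimage_box, ← ENNReal.ofReal_pow (by linarith), ← ENNReal.ofReal_mul
      (by ring_nf; positivity), ← ENNReal.ofReal_mul (by positivity)]
  apply ENNReal.ofReal_le_ofReal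
  have e1 : 1 / (11 / 4 * K * height y) * ((a + K * height y / 4 - a) * (5 / 4 * V - V) ^ (n - 1))
      = 1 / 11 * (V / 4) ^ (n - 1) := by
    rw [show 5 / 4 * V - V = V / 4 by ring, show a + K * height y / 4 - a = K * height y / 4 by ring]
    field_simp
  have e2 : Real.exp (ν * r) = Real.exp r ^ (n - 1) := by
    rw [← Real.exp_nat_mul, Nat.cast_sub (by omega), Nat.cast_one]
  rw [e1, e2, mul_assoc, ← mul_pow]
  gcongr
  have : Real.exp r ≤ 2 * Real.cosh r := by
    rw [Real.cosh_eq]; linarith [Real.exp_pos (-r)]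
  calc 1 / (8 * √(20 * ν)) * Real.exp r ≤ 1 / (8 * √(20 * ν)) * (2 * Real.cosh r) := by gcongr
    _ = V / 4 := by rw [hV]; field_simp; norm_num

/-! ### Slices of the double integral by the difference of levels -/

instance : SFinite (hvol n) := by unfold hvol; infer_instance

lemma hvol_singleton_zero (hn : 2 ≤ n) : hvol n {0} = 0 := by
  have : Nontrivial (Point n) := by
    have : Nonempty (Fin n) := ⟨⟨0, by omega⟩⟩
    infer_instance
  exact withDensity_absolutelyContinuous _ _ (measure_singleton _)

/-- The points of `B(x, r)` whose level differs by `m` from that of `x`. -/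
def ballSlice (x : Point n) (r : ℝ) (m : ℤ) : Set (Point n) :=
  {y | hdist x y < r ∧ (level y : ℤ) = level x + m}

lemma measurableSet_ballSlice_prod {r : ℝ} (hr : 0 < r) (m : ℤ) :
    MeasurableSet {z : Point n × Point n | z.2 ∈ ballSlice z.1 r m} := by
  have h1 : Measurable fun z : Point n × Point n => (level z.2 : ℤ) :=
    (measurable_from_top (f := fun k : ℕ => (k : ℤ))).comp (measurable_level.comp measurable_snd)
  have h2 : Measurable fun z : Point n × Point n => (level z.1 : ℤ) + m :=
    (measurable_from_top (f := fun k : ℕ => (k : ℤ) + m)).comp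
      (measurable_level.comp measurable_fst)
  exact (measurableSet_hdist_lt hr).inter (measurableSet_eq_fun h1 h2)

lemma measurableSet_ballSlice (x : Point n) {r : ℝ} (hr : 0 < r) (m : ℤ) :
    MeasurableSet (ballSlice x r m) :=
  measurable_prodMk_left (x := x) (measurableSet_ballSlice_prod hr m)

lemma mem_ballSlice_comm {x y : Point n} {r : ℝ} {m : ℤ} :
    y ∈ ballSlice x r m ↔ x ∈ ballSlice y r (-m) := by
  simp only [ballSlice, mem_ofPred_eq, hdist_comm x y]
  refine and_congr_right fun _ => ?_
  omega

lemma iUnion_ballSlice (x : Point n) (r : ℝ) : ⋃ m, ballSlice x r m = hball x r := by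
  ext y
  simp only [ballSlice, mem_iUnion, mem_ofPred_eq, hball]
  exact ⟨fun ⟨_, h, _⟩ => h, fun h => ⟨level y - level x, h, by ring⟩⟩

lemma pairwise_disjoint_ballSlice (x : Point n) (r : ℝ) :
    Pairwise (Function.onFun Disjoint (ballSlice x r)) := by
  intro m m' hm
  refine Set.disjoint_left.2 fun y hy hy' => hm ?_
  have := hy.2.symm.trans hy'.2
  omega

theorem exists_hvol_ballSlice_le (hn : 2 ≤ n) :
    ∃ B : ℝ, 0 < B ∧ ∀ (y : Point n) (r : ℝ), 0 < r → ∀ m : ℤ,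
      hvol n (ballSlice y r m) ≤ ENNReal.ofReal (B * Real.exp (((n : ℝ) - 1) * ((r + m) / 2))) := by
  refine ⟨4 * Real.exp 1 * (4 * Real.exp (1 / 2)) ^ (n - 1), by positivity, fun y r hr m => ?_⟩
  rcases le_or_gt 0 ((level y : ℤ) + m) with h | h
  · obtain ⟨j, hj⟩ := Int.eq_ofNat_of_zero_le h
    have hj' : (j : ℝ) = level y + m := by exact_mod_cast hj.symm
    have hset : ballSlice y r m = {x | hdist y x < r ∧ level x = j} := by
      ext x
      simp only [ballSlice, mem_ofPred_eq, hj, Nat.cast_inj]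
    rw [hset]
    convert! hvol_level_inter_hball_le hn y hr j using 4
    rw [hj']; ring
  · have : ballSlice y r m = ∅ := by
      refine eq_empty_of_forall_notMem fun x hx => ?_
      have := hx.2
      omega
    simp [this]

/-- The growth condition on all slices at once. Passing from `r` to the integer `⌈r⌉ + 1` ensures
that every nonempty slice satisfies the constraint `|l - j| ≤ r` of the growth condition. -/
lemma LevelCondition.weightMass_ballSlice_le (hn : 2 ≤ n) {p q δ C : ℝ} {w : Point n → ℝ≥0}
    (hw : LevelCondition p q δ C w) {r : ℝ} (hr : 0 < r) :
    ∀ᵐ x ∂(hvol n), ∀ m : ℤ, weightMass w q (ballSlice x r m) ≤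
      ENNReal.ofReal (C *
        Real.exp (((n : ℝ) - 1) * ((((⌈r⌉₊ + 1 : ℕ) : ℝ) + m) / 2) * (p - δ)) *
        Real.exp (((n : ℝ) - 1) * ((⌈r⌉₊ + 1 : ℕ) : ℝ) * δ)) * ((w x : ℝ≥0∞) ^ p) ^ (q / p) := by
  set R : ℕ := ⌈r⌉₊ + 1 with hR
  have hrR : r + 1 ≤ R := by rw [hR]; push_cast; linarith [Nat.le_ceil r]
  have h0 : ∀ᵐ x ∂(hvol n), x ≠ 0 := measure_eq_zero_iff_ae_notMem.1 (hvol_singleton_zero hn)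
  have hall : ∀ᵐ x ∂(hvol n), ∀ j l : ℕ, 1 ≤ j → 1 ≤ l → |(l : ℤ) - (j : ℤ)| ≤ (R : ℤ) →
      x ∈ annulus n j → weightMass w q (annulus n l ∩ hball x (R : ℝ)) ≤
        ENNReal.ofReal (C * Real.exp (((n : ℝ) - 1) * (((R : ℝ) + l - j) / 2) * (p - δ)) *
          Real.exp (((n : ℝ) - 1) * R * δ)) * ((w x : ℝ≥0∞) ^ p) ^ (q / p) := by
    simp only [ae_all_iff]
    exact fun j l hj hl hjl => hw j l R hj hl (by omega) hjl
  filter_upwards [h0, hall] with x hx0 hx m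
  rcases (ballSlice x r m).eq_empty_or_nonempty with he | ⟨z, hz⟩
  · simp [he, weightMass]
  have hl : level z = (level x : ℤ) + m := hz.2
  have hjl : |(level z : ℤ) - (level x : ℤ)| ≤ (R : ℤ) := by
    have h1 := (abs_level_sub_lt hr hz.1).le.trans hrR
    rw [abs_sub_comm] at h1
    exact_mod_cast h1
  have hle := hx (level x) (level z) (by simp [level]) (by simp [level]) hjl
    ((mem_annulus_iff hx0 (by simp [level])).2 rfl)
  have hm : (m : ℝ) = level z - level x := by
    have : (level z : ℝ) = level x + m := by exact_mod_cast hl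
    linarith
  rw [hm, ← add_sub_assoc]
  refine le_trans (lintegral_mono_set' ?_) hle
  filter_upwards [h0] with y hy0 hy
  refine ⟨(mem_annulus_iff hy0 (by simp [level])).2 ?_, ?_⟩
  · have := hy.2
    omega
  · exact lt_of_lt_of_le (show hdist x y < r from hy.1) (by linarith)

lemma _root_.ENNReal.le_rpow_mul_rpow {t a b : ℝ≥0∞} (ha : t ≤ a) (hb : t ≤ b) {s : ℝ}
    (hs : 0 ≤ s) (hs' : s ≤ 1) : t ≤ a ^ (1 - s) * b ^ s := by
  calc t = t ^ (1 - s) * t ^ s := by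
        rw [← ENNReal.rpow_add_of_nonneg _ _ (by linarith) hs]; simp
    _ ≤ _ := by gcongr

variable {E F : Set (Point n)} {W : Point n → ℝ≥0∞}

lemma measurable_hvol_inter_ballSlice (hE : MeasurableSet E) {r : ℝ} (hr : 0 < r) (m : ℤ) :
    Measurable fun y => hvol n (E ∩ ballSlice y r m) :=
  measurable_measure_prodMk_left ((measurable_snd hE).inter (measurableSet_ballSlice_prod hr m))

lemma lintegral_hvol_inter_hball_eq_tsum (hE : MeasurableSet E) (hW : Measurable W) {r : ℝ}
    (hr : 0 < r) :
    ∫⁻ y in F, hvol n (E ∩ hball y r) * W y ∂(hvol n) =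
      ∑' m : ℤ, ∫⁻ y in F, hvol n (E ∩ ballSlice y r m) * W y ∂(hvol n) := by
  rw [← lintegral_tsum (f := fun m y => hvol n (E ∩ ballSlice y r m) * W y)
    fun m => ((measurable_hvol_inter_ballSlice hE hr m).mul hW).aemeasurable]
  refine lintegral_congr fun y => ?_
  rw [ENNReal.tsum_mul_right, ← iUnion_ballSlice, inter_iUnion, measure_iUnion]
  · exact fun m m' hm => ((pairwise_disjoint_ballSlice y r hm).mono inter_subset_right
      inter_subset_right)
  · exact fun m => hE.inter (measurableSet_ballSlice y hr m)

/-- Tonelli's theorem on a slice. -/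
lemma lintegral_hvol_inter_ballSlice_swap (hW : Measurable W) {r : ℝ} (hr : 0 < r) (m : ℤ) :
    ∫⁻ y in F, hvol n (E ∩ ballSlice y r m) * W y ∂(hvol n) =
      ∫⁻ x in E, ∫⁻ y in F ∩ ballSlice x r (-m), W y ∂(hvol n) ∂(hvol n) := by
  set P : Set (Point n × Point n) := {z | z.2 ∈ ballSlice z.1 r m}
  have hPm : MeasurableSet P := measurableSet_ballSlice_prod hr m
  have hmem : ∀ y x, (y, x) ∈ P ↔ x ∈ ballSlice y r m := fun _ _ => Iff.rfl
  have hg : Measurable fun z : Point n × Point n => P.indicator (fun z => W z.1) z :=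
    (hW.comp measurable_fst).indicator hPm
  calc ∫⁻ y in F, hvol n (E ∩ ballSlice y r m) * W y ∂(hvol n)
      = ∫⁻ y in F, ∫⁻ x in E, P.indicator (fun z => W z.1) (y, x) ∂(hvol n) ∂(hvol n) := by
        refine lintegral_congr fun y => ?_
        have : (fun x => P.indicator (fun z => W z.1) (y, x))
            = (ballSlice y r m).indicator fun _ => W y := by
          ext x
          by_cases h : x ∈ ballSlice y r m
          · rw [indicator_of_mem h, indicator_of_mem ((hmem y x).2 h)]
          · rw [indicator_of_notMem h, indicator_of_notMem (mt (hmem y x).1 h)]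
        rw [this, lintegral_indicator (measurableSet_ballSlice y hr m), setLIntegral_const,
          Measure.restrict_apply (measurableSet_ballSlice y hr m), inter_comm, mul_comm]
    _ = ∫⁻ x in E, ∫⁻ y in F, P.indicator (fun z => W z.1) (y, x) ∂(hvol n) ∂(hvol n) :=
        lintegral_lintegral_swap hg.aemeasurable
    _ = _ := by
        refine lintegral_congr fun x => ?_
        have : (fun y => P.indicator (fun z => W z.1) (y, x))
            = (ballSlice x r (-m)).indicator W := by
          ext y
          by_cases h : x ∈ ballSlice y r m
          · rw [indicator_of_mem (mem_ballSlice_comm.1 h), indicator_of_mem ((hmem y x).2 h)]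
          · rw [indicator_of_notMem (mt mem_ballSlice_comm.2 h),
              indicator_of_notMem (mt (hmem y x).1 h)]
        rw [this, lintegral_indicator (measurableSet_ballSlice x hr _),
          Measure.restrict_restrict (measurableSet_ballSlice x hr _), inter_comm]

/-! ### The two-set inequality -/

lemma lintegral_ballSlice_le_mul_weightMass {B : ℝ}
    (hB : ∀ (y : Point n) (r : ℝ), 0 < r → ∀ m : ℤ,
      hvol n (ballSlice y r m) ≤ ENNReal.ofReal (B * Real.exp (((n : ℝ) - 1) * ((r + m) / 2))))
    {q : ℝ} {w : Point n → ℝ≥0} (hw : Measurable w) (E F : Set (Point n)) {r : ℝ} (hr : 0 < r)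
    (m : ℤ) :
    ∫⁻ y in F, hvol n (E ∩ ballSlice y r m) * (w y : ℝ≥0∞) ^ q ∂(hvol n) ≤
      ENNReal.ofReal (B * Real.exp (((n : ℝ) - 1) * ((r + m) / 2))) * weightMass w q F := by
  rw [weightMass, ← lintegral_const_mul _ (by fun_prop)]
  refine lintegral_mono fun y => ?_
  gcongr
  exact (measure_mono inter_subset_right).trans (hB y r hr m)

/-- After Tonelli, the inner mass `t = w^q(F ∩ slice)` is at most `w^q(F)` and, by the growth
condition, at most a multiple of `w(x)^q`; the bound used is `t = t^{1-p/q} t^{p/q}`. -/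
lemma lintegral_ballSlice_le_of_levelCondition (hn : 2 ≤ n) {p q δ C : ℝ} (hp : 0 < p)
    (hpq : p ≤ q) {w : Point n → ℝ≥0} (hw : Measurable w) (hwc : LevelCondition p q δ C w)
    (E F : Set (Point n)) {r : ℝ} (hr : 0 < r) (m : ℤ) :
    ∫⁻ y in F, hvol n (E ∩ ballSlice y r m) * (w y : ℝ≥0∞) ^ q ∂(hvol n) ≤
      weightMass w q F ^ (1 - p / q) * ENNReal.ofReal (C *
        Real.exp (((n : ℝ) - 1) * ((((⌈r⌉₊ + 1 : ℕ) : ℝ) + (-m : ℤ)) / 2) * (p - δ)) *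
        Real.exp (((n : ℝ) - 1) * ((⌈r⌉₊ + 1 : ℕ) : ℝ) * δ)) ^ (p / q) * weightMass w p E := by
  have hq : 0 < q := hp.trans_le hpq
  have hs : 0 ≤ p / q := by positivity
  have hs' : p / q ≤ 1 := (div_le_one hq).2 hpq
  rw [lintegral_hvol_inter_ballSlice_swap (W := fun y => (w y : ℝ≥0∞) ^ q) (by fun_prop) hr,
    weightMass.eq_1 w p, ← lintegral_const_mul _ (by fun_prop)]
  refine lintegral_mono_ae (ae_restrict_of_ae ?_)
  filter_upwards [hwc.weightMass_ballSlice_le hn hr] with x hx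
  refine (ENNReal.le_rpow_mul_rpow (lintegral_mono_set inter_subset_left)
    ((lintegral_mono_set inter_subset_right).trans (hx (-m))) hs hs').trans (le_of_eq ?_)
  rw [ENNReal.mul_rpow_of_nonneg _ _ hs, ← mul_assoc, ← ENNReal.rpow_mul _ (q / p),
    show q / p * (p / q) = 1 by field_simp, ENNReal.rpow_one]
  rfl

/-- The two bounds for a slice are geometric in the difference `m` of the levels, with opposite
monotonicity, so that the sum over all slices is controlled by the crossing point. -/
theorem exists_lintegral_hvol_inter_hball_le (hn : 2 ≤ n) {p q δ C : ℝ} (hp : 0 < p) (hpq : p ≤ q)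
    (hδ : δ < p) (hC : 0 < C) :
    ∃ C₁ : ℝ, 0 < C₁ ∧ ∀ w : Point n → ℝ≥0, Measurable w → LevelCondition p q δ C w →
      ∀ r : ℝ, 0 < r → ∀ E F : Set (Point n), MeasurableSet E →
        ∫⁻ y in F, hvol n (E ∩ hball y r) * (w y : ℝ≥0∞) ^ q ∂(hvol n) ≤
          ENNReal.ofReal (C₁ * Real.exp (((n : ℝ) - 1) * r * (p / (q / p + p - δ)))) *
            (weightMass w p E ^ (q / p / (q / p + p - δ)) *
              weightMass w q F ^ (1 - 1 / (q / p + p - δ))) := by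
  have hq : 0 < q := hp.trans_le hpq
  have hqp : 1 ≤ q / p := (one_le_div hp).2 hpq
  set D := q / p + p - δ with hD
  have hD0 : 0 < D := by linarith
  have hD1 : 1 ≤ D := by linarith
  set ν : ℝ := (n : ℝ) - 1 with hν
  have hν0 : 0 < ν := by
    have : (2 : ℝ) ≤ n := by exact_mod_cast hn
    linarith
  have hpδ : 0 < p - δ := by linarith
  obtain ⟨B, hB0, hB⟩ := exists_hvol_ballSlice_le hn
  obtain ⟨S, hS0, hS⟩ := exists_tsum_min_exp_le (a := ν / 2 * (p - δ) * (p / q)) (b := ν / 2)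
    (by positivity) (by positivity)
  -- `θ = (q/p)/D` is the weight for which the dependence on `m` cancels in the geometric mean.
  have hden : ν / 2 * (p - δ) * (p / q) + ν / 2 = ν / 2 * (p / q) * D := by
    rw [hD]; field_simp; ring
  have hθ : ν / 2 / (ν / 2 * (p / q) * D) = q / p / D := by field_simp
  have hθ' : ν / 2 * (p - δ) * (p / q) / (ν / 2 * (p / q) * D) = (p - δ) / D := by field_simp
  rw [hden, hθ, hθ'] at hS
  refine ⟨S * (C ^ (1 / D) * B ^ ((p - δ) / D) * Real.exp (ν * 2 * (p / D))), by positivity,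
    fun w hw hwc r hr E F hE => ?_⟩
  set R : ℝ := ((⌈r⌉₊ + 1 : ℕ) : ℝ) with hR
  have hrR : r ≤ R := by rw [hR]; push_cast; linarith [Nat.le_ceil r]
  have hRr : R ≤ r + 2 := by rw [hR]; push_cast; linarith [Nat.ceil_lt_add_one hr.le]
  set A₀ : ℝ := C ^ (p / q) * Real.exp (ν * (p / q) * (R * (p - δ) / 2 + R * δ)) with hA₀
  set B₀ : ℝ := B * Real.exp (ν * (r / 2)) with hB₀
  have hA₀0 : 0 < A₀ := by positivity
  have hB₀0 : 0 < B₀ := by positivity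
  set X := weightMass w p E
  set Y := weightMass w q F
  rw [lintegral_hvol_inter_hball_eq_tsum hE (by fun_prop) hr]
  calc _ ≤ ∑' m : ℤ, min
        (ENNReal.ofReal A₀ * (Y ^ (1 - p / q) * X) *
          ENNReal.ofReal (Real.exp (-(ν / 2 * (p - δ) * (p / q) * (m : ℝ)))))
        (ENNReal.ofReal B₀ * Y * ENNReal.ofReal (Real.exp (ν / 2 * (m : ℝ)))) := by
        refine ENNReal.tsum_le_tsum fun m => le_min ?_ ?_
        · refine (lintegral_ballSlice_le_of_levelCondition hn hp hpq hw hwc E F hr m).trans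
            (le_of_eq ?_)
          rw [ENNReal.ofReal_rpow_of_pos (by positivity), Real.mul_rpow (by positivity)
            (by positivity), Real.mul_rpow (by positivity) (by positivity), ← Real.exp_mul,
            ← Real.exp_mul, mul_assoc (C ^ (p / q)), ← Real.exp_add, mul_right_comm,
            mul_comm (Y ^ (1 - p / q) * X), mul_right_comm (ENNReal.ofReal A₀), ← ENNReal.ofReal_mul (by positivity),
            hA₀, mul_assoc (C ^ (p / q)), ← Real.exp_add]
          congr 4
          rw [Int.cast_neg]
          ring
        · refine (lintegral_ballSlice_le_mul_weightMass hB hw E F hr m).trans (le_of_eq ?_)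
          rw [mul_right_comm, ← ENNReal.ofReal_mul (by positivity), hB₀, mul_assoc B,
            ← Real.exp_add]
          congr 4
          ring
    _ ≤ _ := hS _ _
    _ = ENNReal.ofReal (S * (A₀ ^ (q / p / D) * B₀ ^ ((p - δ) / D))) *
          (X ^ (q / p / D) * Y ^ (1 - 1 / D)) := by
        have h1 : 0 ≤ q / p / D := by positivity
        have h2 : 0 ≤ (p - δ) / D := by positivity
        have h3 : 0 ≤ 1 - p / q := sub_nonneg.2 ((div_le_one hq).2 hpq)
        have h4 : 1 - 1 / D = (1 - p / q) * (q / p / D) + (p - δ) / D := by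
          rw [show p - δ = D - q / p by rw [hD]; ring]
          field_simp
          ring
        rw [ENNReal.mul_rpow_of_nonneg _ _ h1, ENNReal.mul_rpow_of_nonneg _ _ h1,
          ENNReal.mul_rpow_of_nonneg _ _ h2, ← ENNReal.rpow_mul,
          ENNReal.ofReal_rpow_of_pos hA₀0, ENNReal.ofReal_rpow_of_pos hB₀0,
          h4,
          ENNReal.rpow_add_of_nonneg _ _ (by positivity) h2,
          ENNReal.ofReal_mul hS0.le, ENNReal.ofReal_mul (by positivity)]
        ring
    _ ≤ _ := by
        refine mul_le_mul_left (ENNReal.ofReal_le_ofReal ?_) _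
        rw [hA₀, hB₀, Real.mul_rpow (by positivity) (by positivity),
          Real.mul_rpow (by positivity) (by positivity), ← Real.rpow_mul hC.le, ← Real.exp_mul,
          ← Real.exp_mul, show p / q * (q / p / D) = 1 / D by field_simp, mul_assoc S]
        refine mul_le_mul_of_nonneg_left ?_ hS0.le
        rw [mul_mul_mul_comm, mul_assoc (C ^ (1 / D) * B ^ ((p - δ) / D)), ← Real.exp_add,
          ← Real.exp_add]
        refine mul_le_mul_of_nonneg_left (Real.exp_le_exp.2 ?_) (by positivity)
        -- For `R = r` the parts with `δ` combine to the exponent `ν R p / D`.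
        have e1 : ν * (p / q) * (R * (p - δ) / 2 + R * δ) * (q / p / D) +
            ν * (r / 2) * ((p - δ) / D) = ν / D * (R * p - (R - r) * (p - δ) / 2) := by
          field_simp; ring
        have e2 : ν * 2 * (p / D) + ν * r * (p / D) = ν / D * ((r + 2) * p) := by
          field_simp; ring
        rw [e1, e2]
        refine mul_le_mul_of_nonneg_left ?_ (by positivity)
        have := mul_nonneg (sub_nonneg.2 hrR) hpδ.le
        have := mul_le_mul_of_nonneg_right hRr hp.le
        linarith

/-! ### From null measurable sets and weights to measurable ones -/

lemma lintegral_hball_enorm_indicator {E : Set (Point n)} (hE : NullMeasurableSet E (hvol n))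
    (y : Point n) (r : ℝ) :
    ∫⁻ x in hball y r, ‖E.indicator (fun _ => (1 : ℝ)) x‖ₑ ∂(hvol n) =
      hvol n (E ∩ hball y r) := by
  have : (fun x => ‖E.indicator (fun _ => (1 : ℝ)) x‖ₑ) = E.indicator fun _ => 1 := by
    ext x
    by_cases h : x ∈ E <;> simp [h]
  have hE' : NullMeasurableSet E ((hvol n).restrict (hball y r)) :=
    hE.mono_ac Measure.absolutelyContinuous_restrict
  rw [this, lintegral_indicator₀ hE', setLIntegral_one, Measure.restrict_apply₀ hE']

lemma weightMass_congr_ae {w w' : Point n → ℝ≥0} (hw : w =ᵐ[hvol n] w') (s : ℝ)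
    (A : Set (Point n)) : weightMass w s A = weightMass w' s A := by
  refine lintegral_congr_ae (ae_restrict_of_ae ?_)
  filter_upwards [hw] with x hx
  rw [hx]

lemma weightMass_congr_set {A A' : Set (Point n)} (hA : A =ᵐ[hvol n] A') (w : Point n → ℝ≥0)
    (s : ℝ) : weightMass w s A = weightMass w s A' :=
  setLIntegral_congr hA

lemma LevelCondition.congr {p q δ C : ℝ} {w w' : Point n → ℝ≥0} (hw : w =ᵐ[hvol n] w')
    (h : LevelCondition p q δ C w) : LevelCondition p q δ C w' := by
  intro j l r hj hl hr hjl
  filter_upwards [h j l r hj hl hr hjl, hw] with x hx hwx hxj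
  rw [← weightMass_congr_ae hw, ← hwx]
  exact hx hxj

end Hyperbolic

theorem mainTheorem2 (n : ℕ) (hn : 2 ≤ n) (α p q δ β γ C : ℝ)
    (hα : 0 < α) (hαn : α < (n : ℝ)) (hp : 1 ≤ p) (hpn : p < (n : ℝ) / α)
    (hq : 1 / q = 1 / p - α / (n : ℝ))
    (hδ : δ < min p (q / p + p - p / (1 - α / (n : ℝ))))
    (hβ : β = p / ((1 - α / (n : ℝ)) * (q / p + p - δ)))
    (hγ : γ = q / (q / p + p - δ)) (hC : 0 < C) :
    0 < β ∧ β < 1 ∧ β ≤ γ ∧ γ < p ∧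
      ∃ C' : ℝ, 0 < C' ∧ ∀ w : Hyperbolic.Point n → ℝ≥0,
        AEMeasurable w (Hyperbolic.hvol n) →
        Hyperbolic.LevelCondition p q δ C w →
        Hyperbolic.TwoSetCondition α p q β γ C' w := by
  have hn0 : (0 : ℝ) < n := hα.trans hαn
  have hp0 : 0 < p := by linarith
  have hκ1 : 0 < α / n := by positivity
  set κ : ℝ := 1 - α / n with hκ
  have hκ0 : 0 < κ := sub_pos.2 ((div_lt_one hn0).2 hαn)
  have hqinv : 0 < 1 / q := by
    rw [hq, sub_pos, div_lt_div_iff₀ hn0 hp0]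
    have := (lt_div_iff₀ hα).1 hpn
    linarith
  have hq0 : 0 < q := one_div_pos.1 hqinv
  have hpq : p ≤ q := (one_div_le_one_div hq0 hp0).1 (by linarith)
  obtain ⟨hδp, hδq⟩ := lt_min_iff.1 hδ
  set D : ℝ := q / p + p - δ with hD
  have hqp0 : 0 < q / p := by positivity
  have hD0 : 0 < D := by linarith
  have hpκ : p / κ < D := by linarith
  have hκD : p < κ * D := by rwa [div_lt_iff₀' hκ0] at hpκ
  have hpκq : p ≤ κ * q := by
    have h1 : 1 / q ≤ κ / p := by
      rw [hq, hκ, sub_div]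
      have := div_le_self hκ1.le hp
      linarith
    rwa [div_le_div_iff₀ hq0 hp0, one_mul] at h1
  refine ⟨by rw [hβ]; positivity, by rw [hβ, div_lt_one (by positivity)]; exact hκD, ?_, ?_, ?_⟩
  · rw [hβ, hγ, div_le_div_iff₀ (by positivity) hD0]
    calc p * D ≤ κ * q * D := by gcongr
      _ = q * (κ * D) := by ring
  · rw [hγ, div_lt_iff₀ hD0, ← div_lt_iff₀' hp0]
    linarith
  obtain ⟨c, hc0, hc⟩ := Hyperbolic.exists_le_hvol_hball hn
  obtain ⟨C₁, hC₁, h⟩ := Hyperbolic.exists_lintegral_hvol_inter_hball_le hn hp0 hpq hδp hC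
  refine ⟨c ^ (-κ) * C₁, by positivity, fun w hw hwc r hr E F hE _ => ?_⟩
  have hr0 : 0 < r := by linarith
  obtain ⟨w', hw'm, hww⟩ := hw
  obtain ⟨E', hE'm, hEE⟩ : ∃ E', MeasurableSet E' ∧ E' =ᵐ[Hyperbolic.hvol n] E :=
    ⟨_, measurableSet_toMeasurable _ _, hE.toMeasurable_ae_eq⟩
  have hmain := h w' hw'm (hwc.congr hww) r hr0 E' F hE'm
  rw [← Hyperbolic.weightMass_congr_ae hww, ← Hyperbolic.weightMass_congr_ae hww,
    Hyperbolic.weightMass_congr_set hEE] at hmain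
  set A : ℝ := c * Real.exp (((n : ℝ) - 1) * r) with hA
  have hA0 : 0 < A := by positivity
  calc ∫⁻ y in F, Hyperbolic.fracAverage α r (E.indicator fun _ => (1 : ℝ)) y *
          (w y : ℝ≥0∞) ^ q ∂(Hyperbolic.hvol n)
      ≤ ∫⁻ y in F, ENNReal.ofReal (A ^ (-κ)) * (Hyperbolic.hvol n
          (E' ∩ Hyperbolic.hball y r) * (w' y : ℝ≥0∞) ^ q)
          ∂(Hyperbolic.hvol n) := by
        refine lintegral_mono_ae (ae_restrict_of_ae ?_)
        filter_upwards [hww] with y hy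
        rw [← hy, ← mul_assoc]
        gcongr
        have hEy : Hyperbolic.hvol n (E ∩ Hyperbolic.hball y r) =
            Hyperbolic.hvol n (E' ∩ Hyperbolic.hball y r) :=
          measure_congr (ae_eq_set_inter hEE.symm Filter.EventuallyEq.rfl)
        rw [Hyperbolic.fracAverage, Hyperbolic.lintegral_hball_enorm_indicator hE,
          hEy, mul_comm, div_eq_mul_inv,
          ← hκ, Real.rpow_neg hA0.le, ENNReal.ofReal_inv_of_pos (by positivity),
          ← ENNReal.ofReal_rpow_of_pos hA0]
        gcongr
        exact hc y r hr
    _ = ENNReal.ofReal (A ^ (-κ)) * ∫⁻ y in F, Hyperbolic.hvol n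
          (E' ∩ Hyperbolic.hball y r) * (w' y : ℝ≥0∞) ^ q
          ∂(Hyperbolic.hvol n) := lintegral_const_mul' _ _ ENNReal.ofReal_ne_top
    _ ≤ _ := mul_le_mul_right hmain _
    _ = _ := by
        have e1 : q / p / D = γ / p := by rw [hγ]; field_simp
        have e2 : 1 / D = γ / q := by rw [hγ]; field_simp
        have e3 : κ * (β - 1) = p / D - κ := by rw [hβ]; field_simp
        rw [← hκ, ← hD, e1, e2, ← mul_assoc, ← mul_assoc, ← ENNReal.ofReal_mul (by positivity)]
        congr 3
        rw [mul_assoc _ κ, e3, hA, Real.mul_rpow hc0.le (by positivity), ← Real.exp_mul,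
          mul_mul_mul_comm, ← Real.exp_add]
        congr 2
        ring
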